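/- Let $A\in M_d(\mathbb Z)$ be expanding (all its eigenvalues have modulus strictly bigger than $1$), let $\mathcal D\subset\mathbb Z^d$ be a finite nonempty digit set, put $S_v(x)=A^{-1}(x+v)$ for $v\in\mathcal D$, and let $K\subset\mathbb R^d$ be the integral self-affine set of $(A,\mathcal D)$, that is, the unique nonempty compact set with $K=\bigcup_{v\in\mathcal D}S_v(K)$. Let $J\subset\mathbb R^d$ be any nonempty bounded closed invariant set, i.e. $S_v(J)\subset J$ for all $v\in\mathcal D$. For a word $\mathbf u=v_1\cdots v_n$ over $\mathcal D$ write $S_{\mathbf u}=S_{v_1}\circ\cdots\circ S_{v_n}$. Let $X_n$ be the set of words of length $n$, two words $\mathbf u,\mathbf v$ being identified when $S_{\mathbf u}=S_{\mathbf v}$, and let $X=\bigcup_{n\ge 0}X_n$. Let $(X,\mathcal E)$, $\mathcal E=\mathcal E_v\cup\mathcal E_h$, be the induced graph: the vertical edges $\mathcal E_v$ join (the classes of) a word $\mathbf i$ and a one-letter extension $\mathbf i\ell$; the horizontal edges $\mathcal E_h$ join distinct $\mathbf u,\mathbf v\in X_n$ with $S_{\mathbf u}(J)\cap S_{\mathbf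 v}(J)\neq\emptyset$. A horizontal component is a subset $T\subset X_n$, for some $n$, that is maximal among the subsets of $X_n$ which are connected with respect to $\mathcal E_h$. Two horizontal components $T\subset X_n$ and $T'\subset X_m$ are equivalent if there is an affine map $g(x)=A^{n-m}x+A^{-m}\mathbf d$ with $\mathbf d\in\mathbb Z^d$ such that $\{g\circ S_{\mathbf u}:\mathbf u\in T\}=\{S_{\mathbf u'}:\mathbf u'\in T'\}$; this is an equivalence relation. The graph $(X,\mathcal E)$ is called simple if there are only finitely many equivalence classes of horizontal components. Then $K$ is totally disconnected if and only if $(X,\mathcal E)$ is simple. -/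

import Mathlib

namespace SelfAffine

variable {d : ℕ}

/-- The integer matrix `A`, regarded as a real matrix. -/
def realMatrix (A : Matrix (Fin d) (Fin d) ℤ) : Matrix (Fin d) (Fin d) ℝ :=
  A.map (Int.cast : ℤ → ℝ)

/-- The integer vector `v`, regarded as a point of `ℝ^d`. -/
def realVec (v : Fin d → ℤ) : Fin d → ℝ := fun i => (v i : ℝ)

/-- `A` is expanding: all its (complex) eigenvalues have modulus strictly bigger than `1`. -/
def IsExpanding (A : Matrix (Fin d) (Fin d) ℤ) : Prop :=
  ∀ μ ∈ spectrum ℂ (A.map (Int.cast : ℤ → ℂ)), 1 < ‖μ‖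

/-- The map `x ↦ A⁻¹ (x + v)` attached to a digit `v`. -/
noncomputable def digitMap (A : Matrix (Fin d) (Fin d) ℤ) (v : Fin d → ℤ) :
    (Fin d → ℝ) → (Fin d → ℝ) :=
  fun x => (realMatrix A)⁻¹.mulVec (x + realVec v)

/-- `K` is the self-affine set of the pair `(A, D)`: the (unique) nonempty compact set with
`K = ⋃_{v ∈ D} S_v(K)`. -/
structure IsSelfAffineSet (A : Matrix (Fin d) (Fin d) ℤ) (D : Finset (Fin d → ℤ))
    (K : Set (Fin d → ℝ)) : Prop where
  nonempty : K.Nonempty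
  isCompact : IsCompact K
  eq_iUnion : K = ⋃ v ∈ D, digitMap A v '' K

/-- `J` is a nonempty bounded closed invariant set of the iterated function system:
`S_v(J) ⊆ J` for every digit `v`. -/
structure IsInvariantSet (A : Matrix (Fin d) (Fin d) ℤ) (D : Finset (Fin d → ℤ))
    (J : Set (Fin d → ℝ)) : Prop where
  nonempty : J.Nonempty
  isBounded : Bornology.IsBounded J
  isClosed : IsClosed J
  image_subset : ∀ v ∈ D, digitMap A v '' J ⊆ J

/-- The composition `S_u = S_{i₁} ∘ ⋯ ∘ S_{iₙ}` of a finite word `u = i₁ ⋯ iₙ` of digits; the empty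
word gives the identity. -/
noncomputable def wordMap (A : Matrix (Fin d) (Fin d) ℤ) (D : Finset (Fin d → ℤ)) :
    List D → (Fin d → ℝ) → (Fin d → ℝ)
  | [] => id
  | i :: u => digitMap A i ∘ wordMap A D u

/-- Words of the same length are identified when they give the same map. (If `A` is expanding and
`1 ≤ d`, then `S_u = S_v` already forces `u` and `v` to have the same length.) -/
def wordSetoid (A : Matrix (Fin d) (Fin d) ℤ) (D : Finset (Fin d → ℤ)) : Setoid (List D) where
  r u v := u.length = v.length ∧ wordMap A D u = wordMap A D v
  iseqv :=
    ⟨fun _ => ⟨rfl, rfl⟩, fun h => ⟨h.1.symm, h.2.symm⟩,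
      fun h h' => ⟨h.1.trans h'.1, h.2.trans h'.2⟩⟩

/-- The vertex set `X = ⋃ₙ Xₙ`, where `Xₙ` is the set of words of length `n` up to equality of
their maps. -/
def Vertex (A : Matrix (Fin d) (Fin d) ℤ) (D : Finset (Fin d → ℤ)) : Type :=
  Quotient (wordSetoid A D)

/-- The level of a vertex: the common length of its words. -/
def Vertex.level {A : Matrix (Fin d) (Fin d) ℤ} {D : Finset (Fin d → ℤ)} (u : Vertex A D) : ℕ :=
  Quotient.lift (s := wordSetoid A D) List.length (fun _ _ h => h.1) u

/-- The map `S_u` of a vertex `u`. -/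
noncomputable def Vertex.map {A : Matrix (Fin d) (Fin d) ℤ} {D : Finset (Fin d → ℤ)}
    (u : Vertex A D) : (Fin d → ℝ) → (Fin d → ℝ) :=
  Quotient.lift (s := wordSetoid A D) (wordMap A D) (fun _ _ h => h.2) u

/-- The `n`-th level `Xₙ`. -/
def levelSet (A : Matrix (Fin d) (Fin d) ℤ) (D : Finset (Fin d → ℤ)) (n : ℕ) :
    Set (Vertex A D) :=
  {u | u.level = n}

/-- The vertical edges: `u` and `v` are joined when they have representatives one of which extends
the other by one letter at its end. -/
def verticalGraph (A : Matrix (Fin d) (Fin d) ℤ) (D : Finset (Fin d → ℤ)) :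
    SimpleGraph (Vertex A D) :=
  SimpleGraph.fromRel fun u v =>
    ∃ (i : List D) (l : D),
      Quotient.mk (wordSetoid A D) i = u ∧ Quotient.mk (wordSetoid A D) (i ++ [l]) = v

/-- The horizontal edges: distinct `u`, `v` of the same level are joined when
`S_u(J) ∩ S_v(J) ≠ ∅`. (Level `0` has a single vertex, hence no such edge.) -/
def horizontalGraph (A : Matrix (Fin d) (Fin d) ℤ) (D : Finset (Fin d → ℤ))
    (J : Set (Fin d → ℝ)) : SimpleGraph (Vertex A D) where
  Adj u v := u ≠ v ∧ u.level = v.level ∧ ((u.map '' J) ∩ (v.map '' J)).Nonempty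
  symm := ⟨fun _ _ h => ⟨h.1.symm, h.2.1.symm, by rw [Set.inter_comm]; exact h.2.2⟩⟩
  loopless := ⟨fun _ h => h.1 rfl⟩

/-- The graph `(X, E)` with `E = E_v ∪ E_h`. -/
def inducedGraph (A : Matrix (Fin d) (Fin d) ℤ) (D : Finset (Fin d → ℤ))
    (J : Set (Fin d → ℝ)) : SimpleGraph (Vertex A D) :=
  verticalGraph A D ⊔ horizontalGraph A D J

/-- Inside one level, the edges of `(X, E)` are exactly the horizontal ones. -/
theorem inducedGraph_adj_iff_of_level_eq (A : Matrix (Fin d) (Fin d) ℤ) (D : Finset (Fin d → ℤ))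
    (J : Set (Fin d → ℝ)) (u v : Vertex A D) (h : u.level = v.level) :
    (inducedGraph A D J).Adj u v ↔ (horizontalGraph A D J).Adj u v := by
  constructor
  · rintro (h' | h')
    · exfalso
      rw [verticalGraph, SimpleGraph.fromRel_adj] at h'
      obtain ⟨-, ⟨i, l, rfl, rfl⟩ | ⟨i, l, rfl, rfl⟩⟩ := h' <;>
        simp [Vertex.level] at h
    · exact h'
  · exact fun h' => Or.inr h'

/-- `T` is a horizontal component: for some `n`, it is a maximal connected subset of the level `Xₙ`
with respect to the horizontal edges. -/
def IsHorizontalComponent (A : Matrix (Fin d) (Fin d) ℤ) (D : Finset (Fin d → ℤ))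
    (J : Set (Fin d → ℝ)) (T : Set (Vertex A D)) : Prop :=
  ∃ n : ℕ, Maximal
    (fun S : Set (Vertex A D) => S ⊆ levelSet A D n ∧ ((horizontalGraph A D J).induce S).Connected) T

/-- The family `F` of all horizontal components. -/
def HorizontalComponent (A : Matrix (Fin d) (Fin d) ℤ) (D : Finset (Fin d → ℤ))
    (J : Set (Fin d → ℝ)) : Type :=
  {T : Set (Vertex A D) // IsHorizontalComponent A D J T}

/-- The affine map `g(x) = A^{n-m} x + A^{-m} c`, that is `g(x) = A^{-m} (A^n x + c)`. -/
noncomputable def levelMap (A : Matrix (Fin d) (Fin d) ℤ) (n m : ℕ) (c : Fin d → ℤ) :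
    (Fin d → ℝ) → (Fin d → ℝ) :=
  fun x => ((realMatrix A) ^ ((n : ℤ) - (m : ℤ))).mulVec x
    + ((realMatrix A) ^ (-(m : ℤ))).mulVec (realVec c)

/-- Horizontal components `T ⊆ Xₙ` and `T' ⊆ Xₘ` are equivalent when
`{g ∘ S_u : u ∈ T} = {S_u' : u' ∈ T'}` for some `g(x) = A^{n-m} x + A^{-m} c` with `c ∈ ℤ^d`.
Since `S_u(x) = A^{-n} (x + d_u)`, this says that the sets of integer vectors
`{d_u : u ∈ T}` and `{d_u' : u' ∈ T'}` are integer translates of each other. -/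
def ComponentEquiv (A : Matrix (Fin d) (Fin d) ℤ) (D : Finset (Fin d → ℤ))
    (J : Set (Fin d → ℝ)) (T T' : HorizontalComponent A D J) : Prop :=
  ∃ (n m : ℕ) (c : Fin d → ℤ), T.1 ⊆ levelSet A D n ∧ T'.1 ⊆ levelSet A D m ∧
    (fun u : Vertex A D => levelMap A n m c ∘ u.map) '' T.1 = Vertex.map '' T'.1

/-- The graph is simple: there are finitely many equivalence classes of horizontal components.
(For an expanding matrix the relation is an equivalence relation, see
`componentEquiv_equivalence`.) -/
def IsSimple (A : Matrix (Fin d) (Fin d) ℤ) (D : Finset (Fin d → ℤ))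
    (J : Set (Fin d → ℝ)) : Prop :=
  Finite (Quot (ComponentEquiv A D J))

theorem IsExpanding.isUnit_det {A : Matrix (Fin d) (Fin d) ℤ} (hA : IsExpanding A) :
    IsUnit (realMatrix A).det := by
  have h0 : (0 : ℂ) ∉ spectrum ℂ (A.map (Int.cast : ℤ → ℂ)) := fun h => by
    have := hA 0 h
    simp at this
    linarith
  rw [spectrum.zero_notMem_iff, Matrix.isUnit_iff_isUnit_det, isUnit_iff_ne_zero] at h0
  have h1 : (A.map (Int.cast : ℤ → ℂ)).det = ((A.det : ℤ) : ℂ) :=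
    ((Int.castRingHom ℂ).map_det A).symm
  have h2 : (realMatrix A).det = ((A.det : ℤ) : ℝ) := ((Int.castRingHom ℝ).map_det A).symm
  rw [isUnit_iff_ne_zero, h2]
  rw [h1] at h0
  exact_mod_cast h0

theorem levelMap_self {A : Matrix (Fin d) (Fin d) ℤ} (n : ℕ) :
    levelMap A n n 0 = id := by
  funext x
  have : realVec (0 : Fin d → ℤ) = 0 := by funext i; simp [realVec]
  simp [levelMap, this]

theorem levelMap_comp {A : Matrix (Fin d) (Fin d) ℤ} (hA : IsExpanding A) (n m k : ℕ)
    (c c' : Fin d → ℤ) :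
    levelMap A m k c' ∘ levelMap A n m c = levelMap A n k (c + c') := by
  funext x
  have hc : realVec (c + c') = realVec c + realVec c' := by funext i; simp [realVec]
  have h1 : (realMatrix A) ^ ((m : ℤ) - (k : ℤ)) * (realMatrix A) ^ ((n : ℤ) - (m : ℤ))
      = (realMatrix A) ^ ((n : ℤ) - (k : ℤ)) := by
    rw [← Matrix.zpow_add hA.isUnit_det]; congr 1; ring
  have h2 : (realMatrix A) ^ ((m : ℤ) - (k : ℤ)) * (realMatrix A) ^ (-(m : ℤ))
      = (realMatrix A) ^ (-(k : ℤ)) := by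
    rw [← Matrix.zpow_add hA.isUnit_det]; congr 1; ring
  simp only [levelMap, Function.comp_apply, Matrix.mulVec_add, Matrix.mulVec_mulVec, h1, h2, hc]
  abel

theorem HorizontalComponent.nonempty {A : Matrix (Fin d) (Fin d) ℤ} {D : Finset (Fin d → ℤ)}
    {J : Set (Fin d → ℝ)} (T : HorizontalComponent A D J) : T.1.Nonempty := by
  obtain ⟨n, hn⟩ := T.2
  obtain ⟨u⟩ := hn.1.2.nonempty
  exact ⟨u.1, u.2⟩

/-- For an expanding matrix, equivalence of horizontal components is an equivalence relation. -/
theorem componentEquiv_equivalence {A : Matrix (Fin d) (Fin d) ℤ} (hA : IsExpanding A)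
    (D : Finset (Fin d → ℤ)) (J : Set (Fin d → ℝ)) :
    Equivalence (ComponentEquiv A D J) where
  refl T := by
    obtain ⟨n, hn⟩ := T.2
    exact ⟨n, n, 0, hn.1.1, hn.1.1, by simp [levelMap_self]⟩
  symm := by
    rintro T T' ⟨n, m, c, hT, hT', h⟩
    refine ⟨m, n, -c, hT', hT, ?_⟩
    have : (fun u : Vertex A D => levelMap A m n (-c) ∘ u.map) '' T'.1
        = (fun f => levelMap A m n (-c) ∘ f) '' (Vertex.map '' T'.1) := by
      rw [Set.image_image]
    rw [this, ← h, Set.image_image]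
    simp only [← Function.comp_assoc, levelMap_comp hA, add_neg_cancel, levelMap_self,
      Function.id_comp]
  trans := by
    rintro T T' T'' ⟨n, m, c, hT, hT', h⟩ ⟨m', k, c', hT1, hT'', h'⟩
    obtain ⟨u, hu⟩ := T'.nonempty
    obtain rfl : m = m' := (hT' hu).symm.trans (hT1 hu)
    refine ⟨n, k, c + c', hT, hT'', ?_⟩
    rw [← h']
    have : (fun u : Vertex A D => levelMap A m k c' ∘ u.map) '' T'.1
        = (fun f => levelMap A m k c' ∘ f) '' (Vertex.map '' T'.1) := by
      rw [Set.image_image]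
    rw [this, ← h, Set.image_image]
    simp only [← Function.comp_assoc, levelMap_comp hA]

end SelfAffine

/-! Write `S_u(x) = A⁻ⁿ(x + d_u)` with `d_u` an integer vector. Both properties are equivalent to
`HasBoundedComponents`: a uniform bound on `d_u - d_v` over all `u`, `v` in a common horizontal
component.

If `K` is totally disconnected, short-step chains in `K + ℤ^d` stay within `1/2` of their start. For
a fixed large `k`, `w ↦ A⁻ᵏ(y + d_w)` with `y ∈ K` turns a horizontal path into such a chain, since
adjacent vectors differ by an element of `J - J`. Applying `Aᵏ` bounds `d_u - d_v`. Conversely, a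
connected subset of `K` lies, at every level `n`, in the union of `S_u(J)` over one component; under
the bound this union has diameter tending to `0`.

The equivalence of components translates the vectors `d_u`. Bounded components therefore reduce to
subsets of one finite set of integer vectors, and finitely many classes of finite components give a
common bound. -/

open Filter Topology

/-! ### Small-step chains in totally disconnected compact sets -/

/-- Chains in `E` with sufficiently small steps have arbitrarily close ends. -/
def HasSmallChains {X : Type*} [PseudoMetricSpace X] (E : Set X) : Prop :=
  ∀ ε > 0, ∃ δ > 0, ∀ x y,
    Relation.ReflTransGen (fun a b => a ∈ E ∧ b ∈ E ∧ dist a b < δ) x y → dist x y < ε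

theorem HasSmallChains.empty {X : Type*} [PseudoMetricSpace X] :
    HasSmallChains (∅ : Set X) := by
  intro ε hε
  refine ⟨1, one_pos, fun x y h => ?_⟩
  induction h with
  | refl => simpa using hε
  | tail _ h _ => exact h.1.elim

theorem HasSmallChains.image_isometryEquiv {X Y : Type*} [PseudoMetricSpace X]
    [PseudoMetricSpace Y] {E : Set X} (hE : HasSmallChains E) (e : X ≃ᵢ Y) :
    HasSmallChains (e '' E) := by
  intro ε hε
  obtain ⟨δ, hδ, h⟩ := hE ε hε
  refine ⟨δ, hδ, fun x y hxy => ?_⟩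
  rw [← e.symm.dist_eq]
  refine h _ _ (Relation.ReflTransGen.lift e.symm ?_ _ _ hxy)
  rintro _ _ ⟨⟨a, ha, rfl⟩, ⟨b, hb, rfl⟩, hab⟩
  rw [e.dist_eq] at hab
  exact ⟨by simpa using ha, by simpa using hb, by simpa using hab⟩

/-- If excursions into `F` are short enough, the points of `E` visited along a chain form a
small-step chain of `E`, so two nested scales suffice. -/
theorem HasSmallChains.union {X : Type*} [PseudoMetricSpace X] {E F : Set X}
    (hE : HasSmallChains E) (hF : HasSmallChains F) : HasSmallChains (E ∪ F) := by
  intro ε hε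
  obtain ⟨δ₀, hδ₀, h₁⟩ := hE (ε / 3) (by positivity)
  obtain ⟨δ₁, hδ₁, hδ₁₀, hδ₁ε⟩ : ∃ δ₁ > 0, δ₁ ≤ δ₀ ∧ δ₁ ≤ ε / 3 :=
    ⟨min δ₀ (ε / 3), by positivity, min_le_left _ _, min_le_right _ _⟩
  obtain ⟨δ₂, hδ₂, h₂⟩ := hF (δ₁ / 3) (by positivity)
  refine ⟨min δ₂ (δ₁ / 3), by positivity, fun x y hxy => ?_⟩
  set RE : X → X → Prop := fun a b => a ∈ E ∧ b ∈ E ∧ dist a b < δ₀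
  set RF : X → X → Prop := fun a b => a ∈ F ∧ b ∈ F ∧ dist a b < δ₂
  -- Either `E` has not been needed yet, or `e₀` and `e` are the first and latest recorded points of
  -- `E`, and an `F`-run leads from `f` to the current point. Going from `e` to the next recorded
  -- point costs at most three pieces of length `< δ₁ / 3`, hence is a step `< δ₀`.
  have key : Relation.ReflTransGen RF x y ∨ ∃ e₀ e f, e ∈ E ∧ dist x e₀ ≤ 2 * δ₁ / 3 ∧
      Relation.ReflTransGen RE e₀ e ∧ dist e f < δ₁ / 3 ∧ Relation.ReflTransGen RF f y := by
    induction hxy with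
    | refl => exact Or.inl .refl
    | @tail y z _ hyz ih =>
      obtain ⟨hy, hz, hd⟩ := hyz
      have hd₂ : dist y z < δ₂ := hd.trans_le (min_le_left _ _)
      have hd₁ : dist y z < δ₁ / 3 := hd.trans_le (min_le_right _ _)
      by_cases hyE : y ∈ E
      · right
        rcases ih with ih | ⟨e₀, e, f, he, h0, hR, hef, hfy⟩
        · have := h₂ _ _ ih
          exact ⟨y, y, z, hyE, by linarith, .refl, hd₁, .refl⟩
        · have := h₂ _ _ hfy
          have h3 := dist_triangle e f y
          exact ⟨e₀, y, z, hyE, h0, hR.tail ⟨he, hyE, by linarith⟩, hd₁, .refl⟩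
      · have hyF : y ∈ F := hy.resolve_left hyE
        by_cases hzF : z ∈ F
        · rcases ih with ih | ⟨e₀, e, f, he, h0, hR, hef, hfy⟩
          · exact Or.inl (ih.tail ⟨hyF, hzF, hd₂⟩)
          · exact Or.inr ⟨e₀, e, f, he, h0, hR, hef, hfy.tail ⟨hyF, hzF, hd₂⟩⟩
        · have hzE : z ∈ E := hz.resolve_right hzF
          right
          rcases ih with ih | ⟨e₀, e, f, he, h0, hR, hef, hfy⟩
          · have := h₂ _ _ ih
            have h3 := dist_triangle x y z
            exact ⟨z, z, z, hzE, by linarith, .refl, by simpa using hδ₁, .refl⟩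
          · have := h₂ _ _ hfy
            have h3 := dist_triangle4 e f y z
            exact ⟨e₀, z, z, hzE, h0, hR.tail ⟨he, hzE, by linarith⟩, by simpa using hδ₁, .refl⟩
  rcases key with h | ⟨e₀, e, f, he, h0, hR, hef, hfy⟩
  · have := h₂ _ _ h
    linarith
  · have h3 := h₂ _ _ hfy
    have h4 := h₁ _ _ hR
    have h5 := dist_triangle4 x e₀ e f
    have h6 := dist_triangle x f y
    linarith

theorem HasSmallChains.biUnion {X ι : Type*} [PseudoMetricSpace X] {s : Set ι} (hs : s.Finite)
    {E : ι → Set X} (hE : ∀ i, HasSmallChains (E i)) : HasSmallChains (⋃ i ∈ s, E i) := by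
  induction s, hs using Set.Finite.induction_on with
  | empty => simpa using HasSmallChains.empty
  | insert _ _ ih =>
    rw [Set.biUnion_insert]
    exact (hE _).union ih

/-- A clopen piece of `K` is at positive distance from its complement, so a chain with smaller steps
never leaves it; finitely many pieces of small diameter cover `K`. -/
theorem IsCompact.hasSmallChains {X : Type*} [MetricSpace X] {K : Set X} (hK : IsCompact K)
    (hd : IsTotallyDisconnected K) : HasSmallChains K := by
  classical
  intro ε hε
  have : CompactSpace K := isCompact_iff_compactSpace.mp hK
  have : TotallyDisconnectedSpace K := totallyDisconnectedSpace_subtype_iff.mpr hd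
  have hc : ∀ x : K, ∃ C : Set K, IsClopen C ∧ x ∈ C ∧ C ⊆ Metric.ball x (ε / 2) := fun x =>
    compact_exists_isClopen_in_isOpen Metric.isOpen_ball (Metric.mem_ball_self (by positivity))
  choose C hC hxC hCb using hc
  have hsep : ∀ x : K, ∃ δ > 0, ∀ a ∈ C x, ∀ b, dist a b < δ → b ∈ C x := by
    intro x
    obtain ⟨δ, hδ, h⟩ := (hC x).isClosed.isCompact.exists_thickening_subset_open
      (hC x).isOpen subset_rfl
    exact ⟨δ, hδ, fun a ha b hab => h (Metric.mem_thickening_iff.mpr ⟨a, ha, by rwa [dist_comm]⟩)⟩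
  choose δ hδ hstay using hsep
  obtain ⟨t, ht⟩ := isCompact_univ.elim_finite_subcover C (fun x => (hC x).isOpen)
    (fun x _ => Set.mem_iUnion.mpr ⟨x, hxC x⟩)
  obtain ⟨δ', hδ', hle⟩ : ∃ δ' > 0, ∀ i ∈ t, δ' ≤ δ i := by
    clear ht
    induction t using Finset.induction_on with
    | empty => exact ⟨1, one_pos, by simp⟩
    | insert a s _ ih =>
      obtain ⟨r, hr, h⟩ := ih
      refine ⟨min r (δ a), lt_min hr (hδ a), fun i hi => ?_⟩
      rcases Finset.mem_insert.mp hi with rfl | hi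
      · exact min_le_right _ _
      · exact (min_le_left _ _).trans (h i hi)
  refine ⟨δ', hδ', fun x y hxy => ?_⟩
  by_cases hx : x ∈ K
  · obtain ⟨i, hi, hxi⟩ : ∃ i ∈ t, (⟨x, hx⟩ : K) ∈ C i := by
      simpa using ht (Set.mem_univ (⟨x, hx⟩ : K))
    have key : ∃ hy : y ∈ K, (⟨y, hy⟩ : K) ∈ C i := by
      induction hxy with
      | refl => exact ⟨hx, hxi⟩
      | tail _ h ih =>
        obtain ⟨_, hy⟩ := ih
        exact ⟨h.2.1, hstay i _ hy _ (h.2.2.trans_le (hle i hi))⟩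
    obtain ⟨hy, hyi⟩ := key
    have h1 := hCb i hxi
    have h2 := hCb i hyi
    rw [Metric.mem_ball, Subtype.dist_eq] at h1 h2
    have := dist_triangle_right x y (i : X)
    simp only at h1 h2
    linarith
  · rcases Relation.ReflTransGen.cases_head hxy with rfl | ⟨_, h, _⟩
    · simpa using hε
    · exact absurd h.1 hx

/-! ### Contraction of powers of the inverse matrix -/

-- Gelfand's formula: `‖M ^ k‖` is eventually below `r ^ k` for some `r < 1` above the spectral
-- radius.
open scoped Matrix.Norms.Operator in
theorem Matrix.tendsto_norm_pow_of_forall_spectrum_lt {n : Type*} [Fintype n] [DecidableEq n]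
    [Nonempty n] (M : Matrix n n ℂ) (h : ∀ μ ∈ spectrum ℂ M, ‖μ‖ < 1) :
    Tendsto (fun k => ‖M ^ k‖) atTop (𝓝 0) := by
  have hr : spectralRadius ℂ M < 1 := by
    refine spectrum.spectralRadius_lt_of_forall_lt (r := 1) M fun z hz => ?_
    exact_mod_cast h z hz
  obtain ⟨r, hr1, hr2⟩ := ENNReal.lt_iff_exists_nnreal_btwn.mp hr
  have ht := spectrum.pow_nnnorm_pow_one_div_tendsto_nhds_spectralRadius M
  have hev := ht.eventually_lt_const hr1
  have hr3 : (r : ℝ) < 1 := by exact_mod_cast hr2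
  refine squeeze_zero' (Eventually.of_forall fun k => norm_nonneg _) ?_
    (tendsto_pow_atTop_nhds_zero_of_lt_one r.2 hr3)
  filter_upwards [hev, eventually_gt_atTop 0] with k hk hk0
  have hk' : (k : ℝ) ≠ 0 := by positivity
  have := ENNReal.rpow_le_rpow hk.le (z := k) (by positivity)
  rw [← ENNReal.rpow_mul, one_div, inv_mul_cancel₀ hk', ENNReal.rpow_one, ENNReal.rpow_natCast]
    at this
  exact_mod_cast this

namespace SelfAffine

variable {d : ℕ}

open scoped Matrix.Norms.Operator in
/-- The inverse of an expanding matrix is eventually contracting. -/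
theorem IsExpanding.exists_tendsto_norm_inv_pow {A : Matrix (Fin d) (Fin d) ℤ}
    (hA : IsExpanding A) : ∃ η : ℕ → ℝ, Tendsto η atTop (𝓝 0) ∧ (∀ k, 0 ≤ η k) ∧
      ∀ k x, ‖((realMatrix A)⁻¹ ^ k).mulVec x‖ ≤ η k * ‖x‖ := by
  rcases isEmpty_or_nonempty (Fin d) with hd | hd
  · refine ⟨0, tendsto_const_nhds, fun _ => le_rfl, fun k x => ?_⟩
    rw [Subsingleton.elim (((realMatrix A)⁻¹ ^ k).mulVec x) 0]
    simp
  have hmap : A.map (Int.cast : ℤ → ℂ) = (realMatrix A).map (algebraMap ℝ ℂ) := by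
    ext i j
    simp [realMatrix]
  set M := (realMatrix A)⁻¹.map (algebraMap ℝ ℂ) with hM
  have h1 : M * A.map (Int.cast : ℤ → ℂ) = 1 := by
    rw [hmap, hM, ← Matrix.map_mul, Matrix.nonsing_inv_mul _ hA.isUnit_det]
    exact Matrix.map_one _ (map_zero _) (map_one _)
  have h2 : A.map (Int.cast : ℤ → ℂ) * M = 1 := mul_eq_one_comm.mp h1
  let U : (Matrix (Fin d) (Fin d) ℂ)ˣ := ⟨M, _, h1, h2⟩
  have hspec : ∀ μ ∈ spectrum ℂ M, ‖μ‖ < 1 := by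
    intro μ hμ
    have hμ0 : μ ≠ 0 := spectrum.ne_zero_of_mem_of_unit (a := U) hμ
    have := hA _ (spectrum.inv₀_mem_inv_iff (a := U) |>.mpr hμ)
    rw [norm_inv] at this
    exact (one_lt_inv₀ (norm_pos_iff.mpr hμ0)).mp this
  refine ⟨_, Matrix.tendsto_norm_pow_of_forall_spectrum_lt M hspec, fun _ => norm_nonneg _,
    fun k x => ?_⟩
  have hpow : M ^ k = ((realMatrix A)⁻¹ ^ k).map (algebraMap ℝ ℂ) :=
    (map_pow (algebraMap ℝ ℂ).mapMatrix _ k).symm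
  -- The row-sum norm of a real matrix is unchanged by complexification.
  have hn : ‖M ^ k‖ = ‖(realMatrix A)⁻¹ ^ k‖ := by
    rw [hpow, Matrix.linfty_opNorm_def, Matrix.linfty_opNorm_def]
    simp
  rw [hn]
  exact Matrix.linfty_opNorm_mulVec _ _

open scoped Matrix.Norms.Operator in
theorem exists_norm_mulVec_le (M : Matrix (Fin d) (Fin d) ℝ) :
    ∃ C, 0 ≤ C ∧ ∀ x, ‖M.mulVec x‖ ≤ C * ‖x‖ :=
  ⟨‖M‖, norm_nonneg _, Matrix.linfty_opNorm_mulVec M⟩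

theorem realVec_add (v w : Fin d → ℤ) : realVec (v + w) = realVec v + realVec w := by
  ext i; simp [realVec]

theorem realVec_sub (v w : Fin d → ℤ) : realVec (v - w) = realVec v - realVec w := by
  ext i; simp [realVec]

theorem realVec_mulVec (A : Matrix (Fin d) (Fin d) ℤ) (v : Fin d → ℤ) :
    realVec (A.mulVec v) = (realMatrix A).mulVec (realVec v) := by
  ext i
  simp [realVec, realMatrix, Matrix.mulVec, dotProduct]

theorem realMatrix_pow (A : Matrix (Fin d) (Fin d) ℤ) (n : ℕ) :
    realMatrix (A ^ n) = realMatrix A ^ n :=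
  map_pow (Int.castRingHom ℝ).mapMatrix A n

theorem finite_norm_realVec_le (C : ℝ) : {v : Fin d → ℤ | ‖realVec v‖ ≤ C}.Finite := by
  refine (Set.finite_Icc (fun _ => -⌈C⌉ : Fin d → ℤ) (fun _ => ⌈C⌉)).subset fun v hv => ?_
  have h : ∀ i, |(v i : ℝ)| ≤ C := fun i => (norm_le_pi_norm (realVec v) i).trans hv
  refine ⟨fun i => ?_, fun i => ?_⟩
  · have := (abs_le.mp (h i)).1
    have h2 := Int.le_ceil C
    have : ((-⌈C⌉ : ℤ) : ℝ) ≤ v i := by push_cast; linarith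
    exact_mod_cast this
  · have : ((v i : ℤ) : ℝ) ≤ ⌈C⌉ := (abs_le.mp (h i)).2.trans (Int.le_ceil C)
    exact_mod_cast this

/-! ### Chains in the integer translates of the self-affine set -/

/-- Short chains in the union of all integer translates of a totally disconnected compact set
stay close to their starting point. -/
theorem exists_chain_dist_lt_half {K : Set (Fin d → ℝ)} (hK : IsCompact K)
    (hd : IsTotallyDisconnected K) :
    ∃ δ > 0, ∀ x y, Relation.ReflTransGen
      (fun a b => a ∈ {p | ∃ z : Fin d → ℤ, p - realVec z ∈ K} ∧
        b ∈ {p | ∃ z : Fin d → ℤ, p - realVec z ∈ K} ∧ dist a b < δ) x y → dist x y < 1 / 2 := by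
  obtain ⟨R, hR⟩ := hK.isBounded.exists_norm_le
  -- After moving the start of the chain into `K`, only translates meeting its unit neighbourhood
  -- matter; their translation vectors have norm at most `1 + 2 * R`, so they are finitely many.
  have hP : HasSmallChains (⋃ z ∈ {v : Fin d → ℤ | ‖realVec v‖ ≤ 1 + 2 * R},
      IsometryEquiv.addRight (realVec z) '' K) :=
    HasSmallChains.biUnion (finite_norm_realVec_le _)
      fun z => (hK.hasSmallChains hd).image_isometryEquiv _
  set F := ⋃ z ∈ {v : Fin d → ℤ | ‖realVec v‖ ≤ 1 + 2 * R},
      IsometryEquiv.addRight (realVec z) '' K with hF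
  have hmem : ∀ p, p ∈ F ↔ ∃ z : Fin d → ℤ, ‖realVec z‖ ≤ 1 + 2 * R ∧ p - realVec z ∈ K := by
    intro p
    simp only [hF, Set.mem_iUnion, Set.mem_ofPred_eq, exists_prop, Set.mem_image]
    refine exists_congr fun z => and_congr_right fun _ => ?_
    constructor
    · rintro ⟨x, hx, rfl⟩
      simpa using hx
    · exact fun h => ⟨_, h, by simp⟩
  obtain ⟨δ, hδ, h⟩ := hP (1 / 2) (by norm_num)
  refine ⟨min δ (1 / 2), by positivity, fun x y hxy => ?_⟩
  rcases Relation.ReflTransGen.cases_head hxy with rfl | ⟨_, ⟨⟨z, hz⟩, -, -⟩, -⟩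
  · simp
  have hnear : ∀ p, (∃ w : Fin d → ℤ, p - realVec w ∈ K) → dist x p < 1 → p - realVec z ∈ F := by
    rintro p ⟨w, hw⟩ hp
    refine (hmem _).mpr ⟨w - z, ?_, ?_⟩
    · have h1 := hR _ hw
      have h2 := hR _ hz
      rw [dist_eq_norm] at hp
      have : realVec (w - z) = (x - realVec z) - (p - realVec w) - (x - p) := by
        rw [realVec_sub]; abel
      rw [this]
      have h3 := norm_sub_le (x - realVec z - (p - realVec w)) (x - p)
      have h4 := norm_sub_le (x - realVec z) (p - realVec w)
      linarith
    · rw [realVec_sub]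
      simpa using hw
  have key : Relation.ReflTransGen (fun a b => a ∈ F ∧ b ∈ F ∧ dist a b < δ)
      (x - realVec z) (y - realVec z) := by
    -- Bootstrap: the chain so far stays within `1 / 2` of `x` and the next step is below `1 / 2`,
    -- so the next point is still in the finite union `F`.
    induction hxy with
    | refl => exact .refl
    | @tail p q _ hpq ih =>
      have h1 := h _ _ ih
      rw [dist_sub_right] at h1
      have h2 : dist p q < 1 / 2 := hpq.2.2.trans_le (min_le_right _ _)
      have h3 := dist_triangle x p q
      refine ih.tail ⟨hnear p hpq.1 (by linarith), hnear q hpq.2.1 (by linarith), ?_⟩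
      rw [dist_sub_right]
      exact hpq.2.2.trans_le (min_le_left _ _)
  have := h _ _ key
  rwa [dist_sub_right] at this

/-! ### Words, vertices and their integer vectors -/

/-- The integer vector `c` with `S_u(x) = A⁻ⁿ (x + c)`, where `n` is the length of `u`. -/
def wordVec (A : Matrix (Fin d) (Fin d) ℤ) (D : Finset (Fin d → ℤ)) : List D → (Fin d → ℤ)
  | [] => 0
  | i :: u => wordVec A D u + (A ^ u.length).mulVec i

theorem IsExpanding.inv_pow_mulVec_pow_mulVec {A : Matrix (Fin d) (Fin d) ℤ} (hA : IsExpanding A)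
    (n : ℕ) (x : Fin d → ℝ) :
    ((realMatrix A)⁻¹ ^ n).mulVec ((realMatrix A ^ n).mulVec x) = x := by
  rw [Matrix.mulVec_mulVec, Matrix.inv_pow', Matrix.nonsing_inv_mul, Matrix.one_mulVec]
  rw [Matrix.det_pow]
  exact hA.isUnit_det.pow n

theorem IsExpanding.pow_mulVec_inv_pow_mulVec {A : Matrix (Fin d) (Fin d) ℤ} (hA : IsExpanding A)
    (n : ℕ) (x : Fin d → ℝ) :
    (realMatrix A ^ n).mulVec (((realMatrix A)⁻¹ ^ n).mulVec x) = x := by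
  rw [Matrix.mulVec_mulVec, Matrix.inv_pow', Matrix.mul_nonsing_inv, Matrix.one_mulVec]
  rw [Matrix.det_pow]
  exact hA.isUnit_det.pow n

theorem IsExpanding.inv_pow_mulVec_injective {A : Matrix (Fin d) (Fin d) ℤ} (hA : IsExpanding A)
    (n : ℕ) : Function.Injective ((realMatrix A)⁻¹ ^ n).mulVec :=
  Function.LeftInverse.injective (hA.pow_mulVec_inv_pow_mulVec n)

theorem wordMap_apply {A : Matrix (Fin d) (Fin d) ℤ} (hA : IsExpanding A)
    (D : Finset (Fin d → ℤ)) (u : List D) (x : Fin d → ℝ) :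
    wordMap A D u x = ((realMatrix A)⁻¹ ^ u.length).mulVec (x + realVec (wordVec A D u)) := by
  induction u with
  | nil => simp [wordMap, wordVec, realVec, Pi.add_def]
  | cons i u ih =>
    have h := hA.inv_pow_mulVec_pow_mulVec u.length (realVec i)
    rw [wordMap, Function.comp_apply, digitMap, ih, wordVec, realVec_add, realVec_mulVec,
      realMatrix_pow, List.length_cons, pow_succ', ← Matrix.mulVec_mulVec]
    congr 1
    rw [← add_assoc, Matrix.mulVec_add _ (x + _), h]

theorem wordVec_append (A : Matrix (Fin d) (Fin d) ℤ) (D : Finset (Fin d → ℤ)) (u w : List D) :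
    wordVec A D (u ++ w) = wordVec A D w + (A ^ w.length).mulVec (wordVec A D u) := by
  induction u with
  | nil => simp [wordVec]
  | cons i u ih =>
    rw [List.cons_append, wordVec, wordVec, ih, Matrix.mulVec_add, Matrix.mulVec_mulVec, ← pow_add,
      List.length_append, add_comm u.length, add_assoc]

theorem wordMap_mem {A : Matrix (Fin d) (Fin d) ℤ} {D : Finset (Fin d → ℤ)}
    {J : Set (Fin d → ℝ)} (hJ : ∀ v ∈ D, digitMap A v '' J ⊆ J) (u : List D) {x : Fin d → ℝ}
    (hx : x ∈ J) : wordMap A D u x ∈ J := by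
  induction u with
  | nil => exact hx
  | cons i u ih => exact hJ i i.2 ⟨_, ih, rfl⟩

theorem IsSelfAffineSet.image_subset {A : Matrix (Fin d) (Fin d) ℤ} {D : Finset (Fin d → ℤ)}
    {K : Set (Fin d → ℝ)} (hK : IsSelfAffineSet A D K) : ∀ v ∈ D, digitMap A v '' K ⊆ K := by
  intro v hv
  conv_rhs => rw [hK.eq_iUnion]
  exact Set.subset_biUnion_of_mem (u := fun v => digitMap A v '' K) hv

theorem IsSelfAffineSet.exists_wordMap_eq {A : Matrix (Fin d) (Fin d) ℤ}
    {D : Finset (Fin d → ℤ)} {K : Set (Fin d → ℝ)} (hK : IsSelfAffineSet A D K) (n : ℕ)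
    {x : Fin d → ℝ} (hx : x ∈ K) :
    ∃ u : List D, u.length = n ∧ ∃ y ∈ K, wordMap A D u y = x := by
  induction n generalizing x with
  | zero => exact ⟨[], rfl, x, hx, rfl⟩
  | succ n ih =>
    rw [hK.eq_iUnion] at hx
    simp only [Set.mem_iUnion] at hx
    obtain ⟨v, hv, z, hz, rfl⟩ := hx
    obtain ⟨u, hu, y, hy, rfl⟩ := ih hz
    exact ⟨⟨v, hv⟩ :: u, by simp [hu], y, hy, rfl⟩

/-- Every closed bounded invariant set contains the self-affine set. -/
theorem IsSelfAffineSet.subset_invariantSet {A : Matrix (Fin d) (Fin d) ℤ} (hA : IsExpanding A)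
    {D : Finset (Fin d → ℤ)} {K J : Set (Fin d → ℝ)} (hK : IsSelfAffineSet A D K)
    (hJ : IsInvariantSet A D J) : K ⊆ J := by
  intro x hx
  obtain ⟨η, hη, hη0, hle⟩ := hA.exists_tendsto_norm_inv_pow
  obtain ⟨R, hR⟩ := hK.isCompact.isBounded.exists_norm_le
  obtain ⟨j, hj⟩ := hJ.nonempty
  -- Compare `x = S_u(y)` with `S_u(j) ∈ J` for words `u` of length `n`: the two points merge as `n`
  -- grows, and `J` is closed.
  choose u hu y hy hux using fun n => hK.exists_wordMap_eq n hx
  refine hJ.isClosed.mem_of_tendsto (f := fun n => wordMap A D (u n) j) (b := atTop) ?_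
    (Eventually.of_forall fun n => wordMap_mem hJ.image_subset _ hj)
  rw [tendsto_iff_norm_sub_tendsto_zero]
  refine squeeze_zero (fun _ => norm_nonneg _) (fun n => ?_)
    (by simpa using hη.mul_const (‖j‖ + R))
  have : wordMap A D (u n) j - x = ((realMatrix A)⁻¹ ^ n).mulVec (j - y n) := by
    rw [← hux n, wordMap_apply hA, wordMap_apply hA, ← Matrix.mulVec_sub, hu]
    congr 1
    abel
  rw [this]
  refine (hle _ _).trans (mul_le_mul_of_nonneg_left ?_ (hη0 n))
  exact (norm_sub_le _ _).trans (by gcongr; exact hR _ (hy n))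

/-- The integer vector `c` with `S_u(x) = A⁻ⁿ (x + c)`, where `n` is the level of `u`. -/
noncomputable def Vertex.vec {A : Matrix (Fin d) (Fin d) ℤ} {D : Finset (Fin d → ℤ)}
    (u : Vertex A D) : Fin d → ℤ :=
  wordVec A D (Quotient.out u)

theorem Vertex.length_out {A : Matrix (Fin d) (Fin d) ℤ} {D : Finset (Fin d → ℤ)}
    (u : Vertex A D) : (Quotient.out u : List D).length = u.level := by
  conv_rhs => rw [← Quotient.out_eq (s := wordSetoid A D) u]
  rfl

theorem Vertex.map_apply {A : Matrix (Fin d) (Fin d) ℤ} (hA : IsExpanding A)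
    {D : Finset (Fin d → ℤ)} (u : Vertex A D) (x : Fin d → ℝ) :
    u.map x = ((realMatrix A)⁻¹ ^ u.level).mulVec (x + realVec u.vec) := by
  rw [← u.length_out, Vertex.vec, ← wordMap_apply hA]
  conv_lhs => rw [← Quotient.out_eq (s := wordSetoid A D) u]
  rfl

theorem finite_levelSet_le (A : Matrix (Fin d) (Fin d) ℤ) (D : Finset (Fin d → ℤ)) (n : ℕ) :
    {u : Vertex A D | u.level ≤ n}.Finite := by
  refine ((List.finite_length_le D n).image (Quotient.mk (wordSetoid A D))).subset fun u hu => ?_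
  exact ⟨Quotient.out u, (Vertex.length_out u).trans_le hu, Quotient.out_eq u⟩

/-- Split a word of `u` as `ab` with `b` of length `k`: the point equals `S_b(y) + d_a`, and `S_b(y)
∈ K`. -/
theorem vertex_map_vec_mem_translates {A : Matrix (Fin d) (Fin d) ℤ} (hA : IsExpanding A)
    {D : Finset (Fin d → ℤ)} {K : Set (Fin d → ℝ)} (hK : IsSelfAffineSet A D K)
    {y : Fin d → ℝ} (hy : y ∈ K) {k : ℕ} (u : Vertex A D) (hk : k ≤ u.level) :
    ∃ z : Fin d → ℤ,
      ((realMatrix A)⁻¹ ^ k).mulVec (y + realVec u.vec) - realVec z ∈ K := by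
  obtain ⟨a, b, hab, hb⟩ : ∃ a b : List D, Quotient.out u = a ++ b ∧ b.length = k := by
    refine ⟨_, _, (List.take_append_drop (u.level - k) _).symm, ?_⟩
    rw [List.length_drop, u.length_out]
    omega
  refine ⟨wordVec A D a, ?_⟩
  have := wordMap_mem hK.image_subset b hy
  rw [wordMap_apply hA, hb] at this
  rwa [Vertex.vec, hab, wordVec_append, realVec_add, realVec_mulVec, realMatrix_pow, hb,
    ← add_assoc, Matrix.mulVec_add _ (y + _), hA.inv_pow_mulVec_pow_mulVec, add_sub_cancel_right]

/-! ### Horizontal components, and total disconnectedness as boundedness -/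

theorem HorizontalComponent.reachable {A : Matrix (Fin d) (Fin d) ℤ} {D : Finset (Fin d → ℤ)}
    {J : Set (Fin d → ℝ)} (T : HorizontalComponent A D J) {u v : Vertex A D} (hu : u ∈ T.1)
    (hv : v ∈ T.1) : (horizontalGraph A D J).Reachable u v := by
  obtain ⟨n, hn⟩ := T.2
  exact (hn.1.2.preconnected ⟨u, hu⟩ ⟨v, hv⟩).map (SimpleGraph.Embedding.induce T.1).toHom

theorem level_eq_of_reachable {A : Matrix (Fin d) (Fin d) ℤ} {D : Finset (Fin d → ℤ)}
    {J : Set (Fin d → ℝ)} {u v : Vertex A D} (h : (horizontalGraph A D J).Reachable u v) :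
    u.level = v.level := by
  rw [SimpleGraph.reachable_iff_reflTransGen] at h
  induction h with
  | refl => rfl
  | tail _ h ih => exact ih.trans h.2.1

theorem exists_horizontalComponent_of_reachable {A : Matrix (Fin d) (Fin d) ℤ}
    {D : Finset (Fin d → ℤ)} {J : Set (Fin d → ℝ)} {u v : Vertex A D}
    (h : (horizontalGraph A D J).Reachable u v) :
    ∃ T : HorizontalComponent A D J, u ∈ T.1 ∧ v ∈ T.1 := by
  set C := (horizontalGraph A D J).connectedComponentMk u
  have hC := C.maximal_connected_induce_supp
  refine ⟨⟨C.supp, u.level, ⟨fun w hw => ?_, hC.1⟩, fun S hS hle => hC.2 hS.2 hle⟩, rfl, ?_⟩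
  · exact level_eq_of_reachable (SimpleGraph.ConnectedComponent.exact hw)
  · exact SimpleGraph.ConnectedComponent.sound h.symm

/-- The sets of integer vectors belonging to horizontal components are uniformly bounded in
diameter. -/
def HasBoundedComponents (A : Matrix (Fin d) (Fin d) ℤ) (D : Finset (Fin d → ℤ))
    (J : Set (Fin d → ℝ)) : Prop :=
  ∃ C : ℝ, ∀ u v : Vertex A D, (horizontalGraph A D J).Reachable u v →
    ‖realVec u.vec - realVec v.vec‖ ≤ C

theorem hasBoundedComponents_of_isTotallyDisconnected {A : Matrix (Fin d) (Fin d) ℤ}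
    (hA : IsExpanding A) {D : Finset (Fin d → ℤ)} {K J : Set (Fin d → ℝ)}
    (hK : IsSelfAffineSet A D K) (hJ : IsInvariantSet A D J) (hd : IsTotallyDisconnected K) :
    HasBoundedComponents A D J := by
  obtain ⟨δ, hδ, hchain⟩ := exists_chain_dist_lt_half hK.isCompact hd
  obtain ⟨η, hη, hη0, hle⟩ := hA.exists_tendsto_norm_inv_pow
  obtain ⟨M, hM⟩ := hJ.isBounded.exists_norm_le
  obtain ⟨y, hy⟩ := hK.nonempty
  -- Adjacent vertices have vectors differing by a point of `J - J`, of norm at most `M + M`; this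
  -- `k` shrinks that below `δ`. Levels up to `k` have finitely many vertices and are bounded by `C₂
  -- + C₂`.
  obtain ⟨k, hk⟩ : ∃ k, η k * (M + M) < δ := by
    have : Tendsto (fun k => η k * (M + M)) atTop (𝓝 0) := by simpa using hη.mul_const (M + M)
    exact (this.eventually_lt_const hδ).exists
  obtain ⟨C₁, hC₁0, hC₁⟩ := exists_norm_mulVec_le (realMatrix A ^ k)
  obtain ⟨C₂, hC₂⟩ :=
    ((finite_levelSet_le A D k).image fun u => realVec u.vec).isBounded.exists_norm_le
  refine ⟨max C₁ (C₂ + C₂), fun u v huv => ?_⟩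
  have hlev := level_eq_of_reachable huv
  rcases le_total u.level k with h | h
  · refine le_max_of_le_right ((norm_sub_le _ _).trans (add_le_add ?_ ?_))
    · exact hC₂ _ ⟨u, h, rfl⟩
    · exact hC₂ _ ⟨v, hlev.symm.trans_le h, rfl⟩
  · refine le_max_of_le_left ?_
    let p : Vertex A D → Fin d → ℝ :=
      fun w => ((realMatrix A)⁻¹ ^ k).mulVec (y + realVec w.vec)
    have hp : ∀ a b, p a - p b =
        ((realMatrix A)⁻¹ ^ k).mulVec (realVec a.vec - realVec b.vec) := fun a b => by
      simp only [p]
      rw [← Matrix.mulVec_sub, add_sub_add_left_eq_sub]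
    have hlt : dist (p u) (p v) < 1 / 2 := by
      apply hchain
      rw [SimpleGraph.reachable_iff_reflTransGen] at huv
      clear hlev
      induction huv with
      | refl => exact .refl
      | @tail a b hua hab ih =>
        have hla : u.level = a.level :=
          level_eq_of_reachable (SimpleGraph.reachable_iff_reflTransGen u a |>.mpr hua)
        have hlab := hab.2.1
        refine ih.tail ⟨vertex_map_vec_mem_translates hA hK hy a (by omega),
          vertex_map_vec_mem_translates hA hK hy b (by omega), ?_⟩
        obtain ⟨_, ⟨x, hx, rfl⟩, ⟨x', hx', hxx⟩⟩ := hab.2.2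
        rw [Vertex.map_apply hA, Vertex.map_apply hA, hlab] at hxx
        have hxx := hA.inv_pow_mulVec_injective _ hxx
        have hdiff : realVec a.vec - realVec b.vec = x' - x := by
          rw [sub_eq_sub_iff_add_eq_add, add_comm, ← hxx]
        rw [dist_eq_norm, hp, hdiff]
        refine ((hle _ _).trans (mul_le_mul_of_nonneg_left ?_ (hη0 k))).trans_lt hk
        exact (norm_sub_le _ _).trans (add_le_add (hM _ hx') (hM _ hx))
    -- Undo the scaling: `Aᵏ` carries a vector of norm below `1 / 2` to one of norm at most `C₁`.
    rw [← hA.pow_mulVec_inv_pow_mulVec k (realVec u.vec - realVec v.vec), ← hp]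
    rw [dist_eq_norm] at hlt
    exact (hC₁ _).trans (mul_le_of_le_one_right hC₁0 (by linarith))

theorem isTotallyDisconnected_of_hasBoundedComponents {A : Matrix (Fin d) (Fin d) ℤ}
    (hA : IsExpanding A) {D : Finset (Fin d → ℤ)} {K J : Set (Fin d → ℝ)}
    (hK : IsSelfAffineSet A D K) (hJ : IsInvariantSet A D J) (hb : HasBoundedComponents A D J) :
    IsTotallyDisconnected K := by
  intro S hSK hS x hx y hy
  obtain ⟨C, hC⟩ := hb
  obtain ⟨η, hη, hη0, hle⟩ := hA.exists_tendsto_norm_inv_pow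
  obtain ⟨M, hM⟩ := hJ.isBounded.exists_norm_le
  have hJc : IsCompact J := Metric.isCompact_of_isClosed_isBounded hJ.isClosed hJ.isBounded
  have hcover : ∀ n, ∀ z ∈ K, ∃ u : Vertex A D, u.level = n ∧ z ∈ u.map '' J := by
    intro n z hz
    obtain ⟨w, hw, t, ht, rfl⟩ := hK.exists_wordMap_eq n hz
    exact ⟨Quotient.mk (wordSetoid A D) w, hw, t, hK.subset_invariantSet hA hJ ht, rfl⟩
  have hclosed : ∀ n (P : Vertex A D → Prop),
      IsClosed (⋃ u ∈ {u : Vertex A D | u.level = n ∧ P u}, u.map '' J) := by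
    intro n P
    refine Set.Finite.isClosed_biUnion
      ((finite_levelSet_le A D n).subset fun u hu => hu.1.le) fun u _ => ?_
    refine (hJc.image ?_).isClosed
    have : u.map = fun x => ((realMatrix A)⁻¹ ^ u.level).mulVec (x + realVec u.vec) :=
      funext (u.map_apply hA)
    rw [this]
    fun_prop
  have hbound : ∀ n, ‖x - y‖ ≤ η n * (M + M + C) := by
    intro n
    obtain ⟨u, hun, hxu⟩ := hcover n x (hSK hx)
    -- `U` collects the pieces in the component of `u`, `V` the others. Both are closed, and a
    -- common point would give a horizontal edge between them, so the preconnected `S` cannot meet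
    -- both.
    set U := ⋃ v ∈ {v : Vertex A D | v.level = n ∧ (horizontalGraph A D J).Reachable u v},
      v.map '' J with hU
    set V := ⋃ v ∈ {v : Vertex A D | v.level = n ∧ ¬ (horizontalGraph A D J).Reachable u v},
      v.map '' J with hV
    have hyU : y ∈ U := by
      by_contra hyU
      have hSUV : S ⊆ U ∪ V := by
        intro z hz
        obtain ⟨v, hv, hzv⟩ := hcover n z (hSK hz)
        by_cases h : (horizontalGraph A D J).Reachable u v
        · exact Or.inl (Set.mem_iUnion₂.mpr ⟨v, ⟨hv, h⟩, hzv⟩)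
        · exact Or.inr (Set.mem_iUnion₂.mpr ⟨v, ⟨hv, h⟩, hzv⟩)
      have hxU : x ∈ U := Set.mem_iUnion₂.mpr ⟨u, ⟨hun, .refl u⟩, hxu⟩
      obtain ⟨z, -, hzU, hzV⟩ := isPreconnected_closed_iff.mp hS U V (hclosed n _) (hclosed n _)
        hSUV ⟨x, hx, hxU⟩ ⟨y, hy, (hSUV hy).resolve_left hyU⟩
      simp only [hU, hV, Set.mem_iUnion] at hzU hzV
      obtain ⟨v, ⟨hv, huv⟩, hzv⟩ := hzU
      obtain ⟨w, ⟨hw, huw⟩, hzw⟩ := hzV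
      have hvw : v ≠ w := by
        rintro rfl
        exact huw huv
      have hadj : (horizontalGraph A D J).Adj v w := ⟨hvw, hv.trans hw.symm, z, hzv, hzw⟩
      exact huw (huv.trans hadj.reachable)
    simp only [hU, Set.mem_iUnion] at hyU
    obtain ⟨v, ⟨hv, huv⟩, t, ht, rfl⟩ := hyU
    obtain ⟨s, hs, rfl⟩ := hxu
    rw [Vertex.map_apply hA, Vertex.map_apply hA, hun, hv, ← Matrix.mulVec_sub]
    refine (hle _ _).trans (mul_le_mul_of_nonneg_left ?_ (hη0 n))
    rw [add_sub_add_comm]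
    refine (norm_add_le _ _).trans (add_le_add ?_ (hC u v huv))
    exact (norm_sub_le _ _).trans (add_le_add (hM _ hs) (hM _ ht))
  have h0 : ‖x - y‖ ≤ 0 :=
    ge_of_tendsto' (by simpa using hη.mul_const (M + M + C)) hbound
  exact sub_eq_zero.mp (norm_le_zero_iff.mp h0)

/-! ### Simplicity as boundedness -/

theorem levelMap_comp_vertex_map {A : Matrix (Fin d) (Fin d) ℤ} (hA : IsExpanding A)
    {D : Finset (Fin d → ℤ)} (u : Vertex A D) (m : ℕ) (c : Fin d → ℤ) (x : Fin d → ℝ) :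
    levelMap A u.level m c (u.map x) =
      ((realMatrix A)⁻¹ ^ m).mulVec (x + realVec (u.vec + c)) := by
  have hneg : ∀ n : ℕ, (realMatrix A)⁻¹ ^ n = realMatrix A ^ (-(n : ℤ)) := fun n => by
    rw [Matrix.zpow_neg_natCast, Matrix.inv_pow']
  rw [levelMap, Vertex.map_apply hA, hneg, hneg, Matrix.mulVec_mulVec,
    ← Matrix.zpow_add hA.isUnit_det, realVec_add, ← add_assoc, Matrix.mulVec_add _ (x + _)]
  congr 3
  ring

theorem isSimple_of_hasBoundedComponents {A : Matrix (Fin d) (Fin d) ℤ} (hA : IsExpanding A)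
    {D : Finset (Fin d → ℤ)} {J : Set (Fin d → ℝ)} (hb : HasBoundedComponents A D J) :
    IsSimple A D J := by
  obtain ⟨C, hC⟩ := hb
  let base : HorizontalComponent A D J → Vertex A D := fun T => T.nonempty.some
  -- Normalising by a base vertex makes the set of vectors a subset of a fixed finite set; equal
  -- normalised sets are integer translates, hence give equivalent components.
  let f : HorizontalComponent A D J → Set (Fin d → ℤ) :=
    fun T => (fun u : Vertex A D => u.vec - (base T).vec) '' T.1
  have hf : ∀ T, f T ∈ 𝒫 {v : Fin d → ℤ | ‖realVec v‖ ≤ C} := by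
    rintro T _ ⟨u, hu, rfl⟩
    simp only [Set.mem_ofPred_eq, realVec_sub]
    exact hC _ _ (T.reachable hu T.nonempty.some_mem)
  have hfin : Finite (𝒫 {v : Fin d → ℤ | ‖realVec v‖ ≤ C}) :=
    (finite_norm_realVec_le C).finite_subsets
  have hequiv : ∀ T T', f T = f T' → ComponentEquiv A D J T T' := by
    intro T T' h
    obtain ⟨n, hn⟩ := T.2
    obtain ⟨m, hm⟩ := T'.2
    refine ⟨n, m, (base T').vec - (base T).vec, hn.1.1, hm.1.1, ?_⟩
    have hmap : ∀ u ∈ T.1, ∀ u' ∈ T'.1, u.vec - (base T).vec = u'.vec - (base T').vec →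
        levelMap A n m ((base T').vec - (base T).vec) ∘ u.map = u'.map := by
      intro u hu u' hu' huu
      funext x
      obtain rfl : u.level = n := hn.1.1 hu
      obtain rfl : u'.level = m := hm.1.1 hu'
      rw [Function.comp_apply, levelMap_comp_vertex_map hA, Vertex.map_apply hA]
      congr 3
      rw [← sub_eq_zero] at huu ⊢
      rw [← huu]
      abel
    ext g
    constructor
    · rintro ⟨u, hu, rfl⟩
      obtain ⟨u', hu', huu⟩ : u.vec - (base T).vec ∈ f T' := h ▸ ⟨u, hu, rfl⟩
      exact ⟨u', hu', (hmap u hu u' hu' huu.symm).symm⟩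
    · rintro ⟨u', hu', rfl⟩
      obtain ⟨u, hu, huu⟩ : u'.vec - (base T').vec ∈ f T := h ▸ ⟨u', hu', rfl⟩
      exact ⟨u, hu, hmap u hu u' hu' huu⟩
  refine Finite.of_injective
    (fun q : Quot (ComponentEquiv A D J) =>
      (⟨f q.out, hf _⟩ : 𝒫 {v : Fin d → ℤ | ‖realVec v‖ ≤ C})) fun q q' h => ?_
  rw [← Quot.out_eq q, ← Quot.out_eq q']
  exact Quot.sound (hequiv _ _ (Subtype.ext_iff.mp h))

theorem hasBoundedComponents_of_isSimple {A : Matrix (Fin d) (Fin d) ℤ} (hA : IsExpanding A)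
    {D : Finset (Fin d → ℤ)} {J : Set (Fin d → ℝ)} (hs : IsSimple A D J) :
    HasBoundedComponents A D J := by
  have : Finite (Quot (ComponentEquiv A D J)) := hs
  have hrep : ∀ q : Quot (ComponentEquiv A D J), ∃ R : ℝ, ∀ u ∈ q.out.1,
      ‖realVec (Vertex.vec u)‖ ≤ R := by
    intro q
    obtain ⟨n, hn⟩ := q.out.2
    obtain ⟨R, hR⟩ := (((finite_levelSet_le A D n).subset fun u hu => (hn.1.1 hu).le).image
      fun u => realVec u.vec).isBounded.exists_norm_le
    exact ⟨R, fun u hu => hR _ ⟨u, hu, rfl⟩⟩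
  choose R hR using hrep
  obtain ⟨C, hC⟩ := (Set.finite_range R).bddAbove
  refine ⟨C + C, fun u v huv => ?_⟩
  obtain ⟨T, hu, hv⟩ := exists_horizontalComponent_of_reachable huv
  have hTq : ComponentEquiv A D J T (Quot.mk _ T).out :=
    (componentEquiv_equivalence hA D J).quot_mk_eq_iff _ _ |>.mp (Quot.out_eq _).symm
  obtain ⟨n, m, c, hn, hm, h⟩ := hTq
  -- The shift `c` carries the vectors of `T` onto those of the chosen representative of its class;
  -- evaluating the maps at `0` reads this off.
  have key : ∀ w ∈ T.1, ‖realVec w.vec + realVec c‖ ≤ C := by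
    intro w hw
    obtain ⟨w', hw', hww⟩ := h ▸ Set.mem_image_of_mem
      (fun u : Vertex A D => levelMap A n m c ∘ u.map) hw
    obtain rfl : w.level = n := hn hw
    obtain rfl : w'.level = m := hm hw'
    have := congrFun hww 0
    simp only [Function.comp_apply] at this
    rw [levelMap_comp_vertex_map hA, Vertex.map_apply hA] at this
    have := hA.inv_pow_mulVec_injective _ this
    rw [zero_add, zero_add, realVec_add] at this
    rw [← this]
    exact (hR _ _ hw').trans (hC ⟨_, rfl⟩)
  rw [← add_sub_add_right_eq_sub _ _ (realVec c)]
  exact (norm_sub_le _ _).trans (add_le_add (key u hu) (key v hv))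

end SelfAffine

theorem mainTheorem3 {d : ℕ} (A : Matrix (Fin d) (Fin d) ℤ) (hA : SelfAffine.IsExpanding A)
    (D : Finset (Fin d → ℤ)) (K : Set (Fin d → ℝ)) (hK : SelfAffine.IsSelfAffineSet A D K)
    (J : Set (Fin d → ℝ)) (hJ : SelfAffine.IsInvariantSet A D J) :
    IsTotallyDisconnected K ↔ SelfAffine.IsSimple A D J :=
  ⟨fun h => SelfAffine.isSimple_of_hasBoundedComponents hA
      (SelfAffine.hasBoundedComponents_of_isTotallyDisconnected hA hK hJ h),
    fun h => SelfAffine.isTotallyDisconnected_of_hasBoundedComponents hA hK hJ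
      (SelfAffine.hasBoundedComponents_of_isSimple hA h)⟩
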